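/- Let $n,s,k$ be non-negative integers. A matrix $G\in\mathbb F_2^{s\times n}$ with linearly independent rows is a generator matrix of the binary linear code $C\subseteq\mathbb F_2^n$ spanned by its rows; write $G^h$ for its $h$-th column and $e_i$ for the $i$-th unit vector of $\mathbb F_2^s$. Call $G$ a $k$-PIR matrix if for every $i\in\{1,\dots,s\}$ there are $k$ mutually disjoint sets $R_1,\dots,R_k\subseteq\{1,\dots,n\}$ with $\sum_{h\in R_j}G^h=e_i$ for all $j$. Call $G$ systematic if every $e_i$ occurs among its columns (i.e. $G$ contains an $s\times s$ unit matrix), and projective if its columns are pairwise linearly independent. An $s$-dimensional $k$-PIR code of length $n$ is a code having a generator matrix $G\in\mathbb F_2^{s\times n}$ that is a $k$-PIR matrix; it is a systematic $k$-PIR code if $G$ can be chosen to be, in addition, systematic. Let $P(s,k)$ be the smallest length of an $s$-dimensional $k$-PIR code. **Proposition.** 1. $P(6,8)=19$. 2. The matrix $$ \begin{pmatrix} 0&1&0&1&1&1&1&0&1&1&1&1&0&1&1&1&0&1&1\\ 1&1&1&1&0&1&0&1&1&1&1&0&1&1&0&1&1&1&0\\ 1&1&1&1&0&0&1&1&1&1&0&1&1&1&1&1&0&0&1\\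 1&1&0&0&1&1&1&1&1&0&1&1&1&1&0&0&1&1&1\\ 1&1&0&0&0&0&0&0&0&1&1&1&1&1&1&1&1&1&1\\ 0&0&1&1&1&1&1&1&1&1&1&1&1&1&0&0&0&0&0 \end{pmatrix} $$ is the generator matrix of a $6$-dimensional binary linear code of length $19$; it is an $8$-PIR matrix, it is projective, and it is not systematic. 3. Every systematic $6$-dimensional $8$-PIR code of length $n$ satisfies $n\ge 20$. 4. Consequently it is not true that for all $s,k\ge 1$ there is a systematic $s$-dimensional $k$-PIR code of length $P(s,k)$. -/

import Mathlib

namespace PIR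

/-- `G` is a generator matrix of the binary linear code `C` of length `n`: its `s` rows form a
basis of `C` (so `C` is an `[n, s]` code). -/
def IsGeneratorMatrix {s n : ℕ} (G : Matrix (Fin s) (Fin n) (ZMod 2))
    (C : Submodule (ZMod 2) (Fin n → ZMod 2)) : Prop :=
  LinearIndependent (ZMod 2) G.row ∧ Submodule.span (ZMod 2) (Set.range G.row) = C

/-- `R` is a recovery set for the `i`-th unit vector: the columns of `G` indexed by `R` sum
to `e_i`. -/
def IsRecoverySet {s n : ℕ} (G : Matrix (Fin s) (Fin n) (ZMod 2)) (i : Fin s)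
    (R : Finset (Fin n)) : Prop :=
  ∑ h ∈ R, G.col h = Pi.single i 1

/-- Every unit vector has `k` mutually disjoint recovery sets. -/
def IsPIRMatrix {s n : ℕ} (k : ℕ) (G : Matrix (Fin s) (Fin n) (ZMod 2)) : Prop :=
  ∀ i : Fin s, ∃ R : Fin k → Finset (Fin n),
    (∀ j, IsRecoverySet G i (R j)) ∧ ∀ j j', j ≠ j' → Disjoint (R j) (R j')

/-- `G` contains an `s × s` unit matrix, formed by some `s` of its columns. -/
def IsSystematic {s n : ℕ} (G : Matrix (Fin s) (Fin n) (ZMod 2)) : Prop :=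
  ∃ f : Fin s → Fin n, G.submatrix id f = 1

/-- The columns of `G` are pairwise linearly independent. -/
def IsProjective {s n : ℕ} (G : Matrix (Fin s) (Fin n) (ZMod 2)) : Prop :=
  ∀ h h' : Fin n, h ≠ h' → LinearIndependent (ZMod 2) ![G.col h, G.col h']

/-- `C` is an `s`-dimensional `k`-PIR code of length `n`. -/
def IsPIRCode (s k : ℕ) {n : ℕ} (C : Submodule (ZMod 2) (Fin n → ZMod 2)) : Prop :=
  ∃ G : Matrix (Fin s) (Fin n) (ZMod 2), IsGeneratorMatrix G C ∧ IsPIRMatrix k G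

/-- `C` is a systematic `s`-dimensional `k`-PIR code of length `n`: one and the same generator
matrix is systematic and provides the recovery sets. -/
def IsSystematicPIRCode (s k : ℕ) {n : ℕ} (C : Submodule (ZMod 2) (Fin n → ZMod 2)) : Prop :=
  ∃ G : Matrix (Fin s) (Fin n) (ZMod 2),
    IsGeneratorMatrix G C ∧ IsPIRMatrix k G ∧ IsSystematic G

/-- `P(s, k)`: the smallest length of an `s`-dimensional `k`-PIR code. -/
noncomputable def P (s k : ℕ) : ℕ :=
  sInf {n : ℕ | ∃ C : Submodule (ZMod 2) (Fin n → ZMod 2), IsPIRCode s k C}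

/-- The explicit `6 × 19` matrix. -/
def G19 : Matrix (Fin 6) (Fin 19) (ZMod 2) :=
  !![0, 1, 0, 1, 1, 1, 1, 0, 1, 1, 1, 1, 0, 1, 1, 1, 0, 1, 1;
     1, 1, 1, 1, 0, 1, 0, 1, 1, 1, 1, 0, 1, 1, 0, 1, 1, 1, 0;
     1, 1, 1, 1, 0, 0, 1, 1, 1, 1, 0, 1, 1, 1, 1, 1, 0, 0, 1;
     1, 1, 0, 0, 1, 1, 1, 1, 1, 0, 1, 1, 1, 1, 0, 0, 1, 1, 1;
     1, 1, 0, 0, 0, 0, 0, 0, 0, 1, 1, 1, 1, 1, 1, 1, 1, 1, 1;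
     0, 0, 1, 1, 1, 1, 1, 1, 1, 1, 1, 1, 1, 1, 0, 0, 0, 0, 0]

end PIR

/-!
Disjoint recovery sets force every nonzero codeword to have weight at least `8`. Applied in the
quotients of `𝔽₂⁶`, Plotkin's bound then limits the number of columns in a subspace of each
dimension. On the other hand, eight disjoint recovery sets of a unit vector fit into few columns
only if many of them are singletons or pairs, and these put many columns into a small subspace. For
`n ≤ 18` the two estimates contradict each other.

Let `n = 19` and suppose that all six unit vectors are columns. At most one of them has two
singleton recovery sets. Any other one, `v`, has three pairs that avoid some column equal to `v`,
hence lies on three lines of columns, whose union has seven points. Two such unions share at most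
three points if the line joining their centers consists of columns, and at most one otherwise, so
counting incidences shows that nineteen points have room for only four centers.
-/

namespace PIR

open Finset Module Submodule

section MinimumDistance

variable {ι V : Type*} [Fintype ι] [AddCommGroup V] [Module (ZMod 2) V]

/-- The vectors `c h` are the columns of a generator matrix of a binary code of minimum distance at
least `d`. Codewords are encoded by functionals: `f` stands for the word `h ↦ f (c h)`. -/
def HasDistance (d : ℕ) (c : ι → V) : Prop :=
  ∀ f : Dual (ZMod 2) V, f ≠ 0 → d ≤ #{h | f (c h) ≠ 0}

theorem HasDistance.mkQ {d : ℕ} {c : ι → V} (hc : HasDistance d c) (W : Submodule (ZMod 2) V) :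
    HasDistance d (W.mkQ ∘ c) := fun f hf =>
  hc (f ∘ₗ W.mkQ) fun h => hf (W.linearMap_qext (by rw [h, LinearMap.zero_comp]))

theorem two_mul_card_dual_apply_ne_zero_le [Fintype (Dual (ZMod 2) V)] (x : V) :
    2 * #{f : Dual (ZMod 2) V | f x ≠ 0} ≤ Fintype.card (Dual (ZMod 2) V) := by
  classical
  rcases Finset.eq_empty_or_nonempty {f : Dual (ZMod 2) V | f x ≠ 0} with hempty | ⟨f₀, hf₀⟩
  · simp [hempty]
  have add_eq_zero : ∀ a b : ZMod 2, a ≠ 0 → b ≠ 0 → a + b = 0 := by decide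
  have htranslate : #{f : Dual (ZMod 2) V | f x ≠ 0} ≤ #{f : Dual (ZMod 2) V | ¬ f x ≠ 0} :=
    card_le_card_of_injOn (f₀ + ·)
      (fun f hf => by simpa using add_eq_zero _ _ (mem_filter.1 hf₀).2 (mem_filter.1 hf).2)
      (add_right_injective f₀).injOn
  have hsplit := card_filter_add_card_filter_not (s := univ) fun f : Dual (ZMod 2) V => f x ≠ 0
  rw [card_univ] at hsplit
  omega

theorem HasDistance.plotkin [Module.Finite (ZMod 2) V] [DecidableEq V] {d : ℕ} {c : ι → V}
    (hc : HasDistance d c) :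
    2 * d * 2 ^ finrank (ZMod 2) V ≤ #{h | c h ≠ 0} * 2 ^ finrank (ZMod 2) V + 2 * d := by
  classical
  have : Finite (Dual (ZMod 2) V) := Module.finite_of_finite (ZMod 2)
  have : Fintype (Dual (ZMod 2) V) := Fintype.ofFinite _
  have hcard : Fintype.card (Dual (ZMod 2) V) = 2 ^ finrank (ZMod 2) V := by
    rw [Module.card_eq_pow_finrank (K := ZMod 2), ZMod.card, Subspace.dual_finrank_eq]
  rw [← hcard]
  have hlower : d * Fintype.card (Dual (ZMod 2) V) ≤
      ∑ f : Dual (ZMod 2) V, #{h | f (c h) ≠ 0} + d := by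
    calc d * Fintype.card (Dual (ZMod 2) V) = ∑ _f : Dual (ZMod 2) V, d := by simp [mul_comm]
      _ = ∑ _f ∈ univ.erase (0 : Dual (ZMod 2) V), d + d := (sum_erase_add _ _ (mem_univ 0)).symm
      _ ≤ ∑ f ∈ univ.erase (0 : Dual (ZMod 2) V), #{h | f (c h) ≠ 0} + d := by
          gcongr with f hf
          exact hc f (ne_of_mem_erase hf)
      _ ≤ _ := by
          gcongr
          exact subset_univ _
  have hupper : 2 * ∑ f : Dual (ZMod 2) V, #{h | f (c h) ≠ 0} ≤
      #{h | c h ≠ 0} * Fintype.card (Dual (ZMod 2) V) := by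
    calc 2 * ∑ f : Dual (ZMod 2) V, #{h | f (c h) ≠ 0}
        = ∑ h, 2 * #{f : Dual (ZMod 2) V | f (c h) ≠ 0} := by
          rw [← mul_sum]
          exact congrArg _ (sum_card_bipartiteAbove_eq_sum_card_bipartiteBelow
            fun (f : Dual (ZMod 2) V) h => f (c h) ≠ 0)
      _ = ∑ h with c h ≠ 0, 2 * #{f : Dual (ZMod 2) V | f (c h) ≠ 0} :=
          (sum_filter_of_ne fun h _ => mt fun (h0 : c h = 0) => by simp [h0]).symm
      _ ≤ ∑ h with c h ≠ 0, Fintype.card (Dual (ZMod 2) V) :=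
          sum_le_sum fun h _ => two_mul_card_dual_apply_ne_zero_le (c h)
      _ = _ := by rw [sum_const, smul_eq_mul]
  linarith

/-- Any `r` vectors span at most `t` of the vectors `c h`, counted with multiplicity: the form in
which a lower bound on the minimum distance limits how columns accumulate in subspaces. -/
def SpanCardLE (r t : ℕ) (c : ι → V) : Prop :=
  ∀ B : Finset V, #B ≤ r → ∀ T : Finset ι, (∀ h ∈ T, c h ∈ span (ZMod 2) (B : Set V)) → #T ≤ t

theorem HasDistance.spanCardLE [Module.Finite (ZMod 2) V] {d r t : ℕ} {c : ι → V}
    (hc : HasDistance d c) (ht : Fintype.card ι * 2 ^ (finrank (ZMod 2) V - r) + 2 * d <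
      (2 * d + (t + 1)) * 2 ^ (finrank (ZMod 2) V - r)) : SpanCardLE r t c := by
  classical
  intro B hB T hT
  set W := span (ZMod 2) (B : Set V)
  have houtside : #{h | (W.mkQ ∘ c) h ≠ 0} + #T ≤ Fintype.card ι := by
    rw [← card_univ, ← card_filter_add_card_filter_not (s := univ) fun h => (W.mkQ ∘ c) h ≠ 0]
    gcongr
    intro h hh
    simpa using hT h hh
  obtain ⟨e, he⟩ : ∃ e, finrank (ZMod 2) (V ⧸ W) = finrank (ZMod 2) V - r + e := by
    have hquot := W.finrank_quotient_add_finrank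
    have hW : finrank (ZMod 2) W ≤ r := (finrank_span_finset_le_card B).trans hB
    exact Nat.exists_eq_add_of_le (by omega)
  have hplotkin := (hc.mkQ W).plotkin
  rw [he, pow_add] at hplotkin
  by_contra! htT
  refine ht.not_ge (Nat.le_of_mul_le_mul_right (c := 2 ^ e) ?_ (by positivity))
  have he_pos : 1 ≤ 2 ^ e := Nat.one_le_two_pow
  calc (2 * d + (t + 1)) * 2 ^ (finrank (ZMod 2) V - r) * 2 ^ e
      ≤ (2 * d + #T) * 2 ^ (finrank (ZMod 2) V - r) * 2 ^ e := by gcongr; omega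
    _ ≤ (#{h | (W.mkQ ∘ c) h ≠ 0} + #T) * (2 ^ (finrank (ZMod 2) V - r) * 2 ^ e) + 2 * d := by
        linarith
    _ ≤ Fintype.card ι * (2 ^ (finrank (ZMod 2) V - r) * 2 ^ e) + 2 * d * 2 ^ e :=
        Nat.add_le_add (Nat.mul_le_mul_right _ houtside) (Nat.le_mul_of_pos_right _ he_pos)
    _ = _ := by ring

end MinimumDistance

section Dependencies

variable {ι V : Type*} [Fintype ι] [AddCommGroup V] [Module (ZMod 2) V]

theorem sum_support_eq_linearCombination (q : ι → V) (a : ι → ZMod 2) :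
    ∑ i with a i ≠ 0, q i = Fintype.linearCombination (ZMod 2) q a := by
  have hone : ∀ t : ZMod 2, t ≠ 0 → t = 1 := by decide
  rw [Fintype.linearCombination_apply, sum_filter]
  refine sum_congr rfl fun i _ => ?_
  split_ifs with hi
  · rw [hone _ hi, one_smul]
  · rw [not_not.1 hi, zero_smul]

theorem card_support_add_le (a b : ι → ZMod 2) :
    #{i | a i ≠ 0} + #{i | b i ≠ 0} + #{i | (a + b) i ≠ 0} ≤ 2 * Fintype.card ι := by
  have hpointwise : ∀ x y : ZMod 2, (if x ≠ 0 then 1 else 0) + (if y ≠ 0 then 1 else 0) +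
      (if x + y ≠ 0 then 1 else 0) ≤ 2 := by decide
  simp only [card_filter, ← sum_add_distrib]
  refine (sum_le_card_nsmul _ _ 2 fun i _ => hpointwise (a i) (b i)).trans ?_
  rw [card_univ, smul_eq_mul, mul_comm]

theorem exists_short_dependency [Module.Finite (ZMod 2) V] (q : ι → V)
    (hι : finrank (ZMod 2) V + 2 ≤ Fintype.card ι) :
    ∃ A : Finset ι, A.Nonempty ∧ 3 * #A ≤ 2 * Fintype.card ι ∧ ∑ i ∈ A, q i = 0 := by
  classical
  let Φ := Fintype.linearCombination (ZMod 2) q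
  have hker : 1 < finrank (ZMod 2) (LinearMap.ker Φ) := by
    have hrank := Φ.finrank_range_add_finrank_ker
    have hrange := (LinearMap.range Φ).finrank_le
    rw [finrank_fintype_fun_eq_card] at hrank
    omega
  have : Nontrivial Φ.ker := nontrivial_of_finrank_pos (R := ZMod 2) (zero_lt_one.trans hker)
  obtain ⟨a, ha⟩ := exists_ne (0 : Φ.ker)
  obtain ⟨b, hab⟩ := exists_linearIndependent_pair_of_one_lt_finrank hker ha
  have hb : b ≠ 0 := hab.ne_zero 1
  have hab : a + b ≠ 0 := fun h => by
    simpa using (LinearIndependent.pair_iff.1 hab 1 1 (by simpa using h)).1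
  -- One of the dependencies `a`, `b`, `a + b` is short, as no index lies in all three supports.
  by_contra! hlong
  have hweight : ∀ x : Φ.ker, x ≠ 0 → 2 * Fintype.card ι < 3 * #{i | x.1 i ≠ 0} := fun x hx => by
    by_contra! hle
    have hsupp : ({i | x.1 i ≠ 0} : Finset ι).Nonempty := by
      obtain ⟨i, hi⟩ := Function.ne_iff.1 (Subtype.coe_ne_coe.2 hx)
      exact ⟨i, by simpa using hi⟩
    exact hlong _ hsupp hle ((sum_support_eq_linearCombination q x.1).trans x.2)
  have hsum := card_support_add_le a.1 b.1
  have := hweight a ha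
  have := hweight b hb
  have := hweight (a + b) hab
  rw [Submodule.coe_add] at this
  omega

theorem exists_mem_span_insert_image_erase {κ : Type*} [DecidableEq κ] [DecidableEq V]
    [Module.Finite (ZMod 2) V] {v : V} (hv : v ≠ 0) (q : κ → V) {s : Finset κ}
    (hs : finrank (ZMod 2) V + 1 ≤ #s) : ∃ A ⊆ s, 3 * #A ≤ 2 * #s ∧ ∃ l ∈ A,
      q l ∈ span (ZMod 2) ((insert v ((A.erase l).image q) : Finset V) : Set V) := by
  let N := span (ZMod 2) ({v} : Set V)
  have hN : finrank (ZMod 2) (V ⧸ N) + 1 = finrank (ZMod 2) V := by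
    rw [← N.finrank_quotient_add_finrank, finrank_span_singleton hv]
  obtain ⟨A, ⟨l, hl⟩, hcard, hsum⟩ := exists_short_dependency (fun j : s => N.mkQ (q j))
    (by rw [Fintype.card_coe]; omega)
  rw [Fintype.card_coe] at hcard
  refine ⟨A.map (.subtype _), map_subtype_subset A, by rwa [card_map], l,
    mem_map_of_mem _ hl, ?_⟩
  have hsum : ∑ j ∈ A.map (.subtype _), q j ∈ N := by
    rw [← Quotient.mk_eq_zero, ← mkQ_apply, map_sum, sum_map]
    exact hsum
  rw [← add_sum_erase _ _ (mem_map_of_mem _ hl)] at hsum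
  refine (Submodule.add_mem_iff_left _ (sum_mem fun j hj => subset_span ?_)).1
    (span_mono ?_ hsum)
  · exact mem_coe.2 (mem_insert_of_mem (mem_image_of_mem q hj))
  · simp

theorem exists_subset_forall_mem_span {κ : Type*} [Module.Finite (ZMod 2) V] {v : V} (hv : v ≠ 0)
    (q : κ → V) {s : Finset κ} {m : ℕ} (hs : finrank (ZMod 2) V + 1 ≤ #s) (hms : m ≤ #s)
    (hm : 2 * #s < 3 * (m + 1)) : ∃ T ⊆ s, #T = m ∧ ∃ B : Finset V, #B ≤ m ∧
      v ∈ span (ZMod 2) (B : Set V) ∧ ∀ j ∈ T, q j ∈ span (ZMod 2) (B : Set V) := by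
  classical
  obtain ⟨A, hA, hAcard, l, hl, hspan⟩ := exists_mem_span_insert_image_erase hv q hs
  obtain ⟨T, hAT, hT, hTcard⟩ := exists_subsuperset_card_eq (n := m) hA (by omega) hms
  refine ⟨T, hT, hTcard, insert v ((T.erase l).image q), ?_, subset_span (by simp),
    fun j hj => ?_⟩
  · rw [← hTcard, ← card_erase_add_one (hAT hl)]
    exact (card_insert_le _ _).trans (Nat.succ_le_succ card_image_le)
  · obtain rfl | hne := eq_or_ne j l
    · exact span_mono (coe_subset.2 (insert_subset_insert _
        (image_subset_image (erase_subset_erase _ hAT)))) hspan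
    · exact subset_span (mem_coe.2 (mem_insert_of_mem
        (mem_image_of_mem q (mem_erase.2 ⟨hne, hj⟩))))

end Dependencies

section RecoveryFamilies

/-- The disjoint sets `R j` of indices, each of which recovers `v` as the sum of its vectors `c h`:
the notion behind a `k`-PIR matrix, without coordinates. -/
structure IsRecoveryFamily {ι κ V : Type*} [AddCommGroup V] (c : ι → V) (v : V)
    (R : κ → Finset ι) : Prop where
  sum_eq : ∀ j, ∑ h ∈ R j, c h = v
  disjoint : ∀ j j', j ≠ j' → Disjoint (R j) (R j')

namespace IsRecoveryFamily

variable {ι κ V : Type*} [AddCommGroup V] {c : ι → V} {v : V} {R : κ → Finset ι}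

theorem nonempty (hR : IsRecoveryFamily c v R) (hv : v ≠ 0) (j : κ) : (R j).Nonempty :=
  nonempty_of_sum_ne_zero ((hR.sum_eq j).trans_ne hv)

theorem card_le_card_of_meets (hR : IsRecoveryFamily c v R) {J : Finset κ} {S : Finset ι}
    (hS : ∀ j ∈ J, ∃ h ∈ R j, h ∈ S) : #J ≤ #S := by
  classical
  calc #J ≤ #(J.biUnion fun j => R j ∩ S) := by
        refine card_le_card_biUnion (fun j _ j' _ hne => ?_) fun j hj => ?_
        · exact (hR.disjoint j j' hne).mono inter_subset_left inter_subset_left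
        · obtain ⟨h, hh, hhS⟩ := hS j hj
          exact ⟨h, mem_inter.2 ⟨hh, hhS⟩⟩
    _ ≤ #S := card_le_card (biUnion_subset.2 fun j _ => inter_subset_right)

theorem card_biUnion [DecidableEq ι] (hR : IsRecoveryFamily c v R) (J : Finset κ) :
    #(J.biUnion R) = ∑ j ∈ J, #(R j) :=
  Finset.card_biUnion fun j _ j' _ => hR.disjoint j j'

theorem apply_eq_of_card_eq_one (hR : IsRecoveryFamily c v R) {j : κ} (hj : #(R j) = 1) {h : ι}
    (hh : h ∈ R j) : c h = v := by
  obtain ⟨p, hp⟩ := card_eq_one.1 hj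
  rw [hp, mem_singleton] at hh
  rw [← hR.sum_eq j, hp, sum_singleton, hh]

theorem apply_add_apply_of_card_eq_two (hR : IsRecoveryFamily c v R) {j : κ} (hj : #(R j) = 2)
    {p h : ι} (hp : p ∈ R j) (hh : h ∈ R j) (hne : p ≠ h) : c p + c h = v := by
  classical
  have hpair : {p, h} = R j := eq_of_subset_of_card_le
    (by simp [insert_subset_iff, hp, hh]) (by rw [hj, card_pair hne])
  rw [← hR.sum_eq j, ← hpair, sum_pair hne]

theorem card_singletons_le [Fintype ι] [Fintype κ] [DecidableEq V] (hR : IsRecoveryFamily c v R) :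
    #{j | #(R j) = 1} ≤ #{h | c h = v} := by
  refine hR.card_le_card_of_meets fun j hj => ?_
  have hj1 := (mem_filter.1 hj).2
  obtain ⟨h, hh⟩ := card_pos.1 (hj1 ▸ one_pos)
  exact ⟨h, hh, by simpa using hR.apply_eq_of_card_eq_one hj1 hh⟩

theorem three_mul_card_le [Fintype ι] [Fintype κ] (hR : IsRecoveryFamily c v R) (hv : v ≠ 0) :
    3 * Fintype.card κ ≤ Fintype.card ι + 2 * #{j | #(R j) = 1} + #{j | #(R j) = 2} := by
  classical
  have hlength : ∑ j, #(R j) ≤ Fintype.card ι := by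
    rw [← hR.card_biUnion]
    exact card_le_univ _
  have hsize : ∑ j : κ, 3 ≤ ∑ j, (#(R j) + 2 * (if #(R j) = 1 then 1 else 0) +
      if #(R j) = 2 then 1 else 0) := sum_le_sum fun j _ => by
    have := (hR.nonempty hv j).card_pos
    split_ifs <;> omega
  rw [sum_add_distrib, sum_add_distrib, ← mul_sum, ← card_filter, ← card_filter, sum_const,
    card_univ, smul_eq_mul] at hsize
  omega

theorem exists_three_pairs [Fintype κ] (hR : IsRecoveryFamily c v R)
    (hlarge : 5 ≤ 2 * #{j | #(R j) = 1} + #{j | #(R j) = 2}) (hJ₁ : #{j | #(R j) = 1} ≤ 1)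
    {h : ι} (hh : c h = v) :
    ∃ h₀, c h₀ = v ∧ ∃ J : Finset κ, 3 ≤ #J ∧ ∀ j ∈ J, #(R j) = 2 ∧ h₀ ∉ R j := by
  classical
  set J₂ : Finset κ := {j | #(R j) = 2}
  obtain hempty | ⟨j₁, hj₁⟩ := eq_empty_or_nonempty ({j | #(R j) = 1} : Finset κ)
  · refine ⟨h, hh, {j ∈ J₂ | h ∉ R j}, ?_, by simp [J₂]⟩
    have hone : #{j ∈ J₂ | h ∈ R j} ≤ #{h} :=
      hR.card_le_card_of_meets fun j hj => ⟨h, (mem_filter.1 hj).2, mem_singleton_self h⟩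
    have hsplit := card_filter_add_card_filter_not (s := J₂) fun j => h ∈ R j
    rw [hempty, card_empty] at hlarge
    rw [card_singleton] at hone
    omega
  · have hj₁ := (mem_filter.1 hj₁).2
    obtain ⟨h₁, hh₁⟩ := card_pos.1 (hj₁ ▸ one_pos)
    refine ⟨h₁, hR.apply_eq_of_card_eq_one hj₁ hh₁, J₂, by omega, fun j hj => ?_⟩
    have hj := (mem_filter.1 hj).2
    refine ⟨hj, disjoint_left.1 (hR.disjoint j₁ j ?_) hh₁⟩
    rintro rfl
    omega

variable [Module (ZMod 2) V]

theorem card_le_card_apply_ne_zero [Fintype ι] [Fintype κ] (hR : IsRecoveryFamily c v R)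
    {f : Dual (ZMod 2) V} (hf : f v ≠ 0) : Fintype.card κ ≤ #{h | f (c h) ≠ 0} := by
  refine hR.card_le_card_of_meets (J := univ) fun j _ => ?_
  rw [← hR.sum_eq j, map_sum] at hf
  obtain ⟨h, hh, hne⟩ := exists_ne_zero_of_sum_ne_zero hf
  exact ⟨h, hh, by simpa using hne⟩

theorem apply_mem_of_card_eq_two (hR : IsRecoveryFamily c v R) {j : κ} (hj : #(R j) = 2)
    {W : Submodule (ZMod 2) V} (hv : v ∈ W) {p h : ι} (hp : p ∈ R j) (hpW : c p ∈ W)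
    (hh : h ∈ R j) : c h ∈ W := by
  obtain rfl | hne := eq_or_ne p h
  · exact hpW
  · rw [← hR.apply_add_apply_of_card_eq_two hj hp hh hne] at hv
    exact (W.add_mem_iff_right hpW).1 hv

/-- A pair adds two columns to a subspace that contains `v`, but at most one dimension. -/
theorem card_add_two_mul_card_le (hR : IsRecoveryFamily c v R) {t : ℕ} {B : Finset V}
    {J : Finset κ} (hc : SpanCardLE (#B + #J) t c) (hJ : ∀ j ∈ J, #(R j) = 2)
    (hv : v ∈ span (ZMod 2) (B : Set V)) {S : Finset ι}
    (hS : ∀ h ∈ S, c h ∈ span (ZMod 2) (B : Set V)) (hdisj : ∀ j ∈ J, Disjoint S (R j)) :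
    #S + 2 * #J ≤ t := by
  classical
  have hex : ∀ j : J, ∃ h, h ∈ R j := fun j => card_pos.1 (hJ j j.2 ▸ two_pos)
  choose p hp using hex
  let B' := B ∪ J.attach.image (c ∘ p)
  have hBB' : span (ZMod 2) (B : Set V) ≤ span (ZMod 2) (B' : Set V) := span_mono (by simp [B'])
  have hcard : #(S ∪ J.biUnion R) = #S + 2 * #J := by
    rw [card_union_of_disjoint ((disjoint_biUnion_right S J R).2 hdisj), hR.card_biUnion,
      sum_const_nat hJ, mul_comm]
  rw [← hcard]
  refine hc B' ((card_union_le _ _).trans ?_) _ fun h hh => ?_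
  · gcongr
    exact card_image_le.trans_eq card_attach
  · rcases mem_union.1 hh with hh | hh
    · exact hBB' (hS h hh)
    · obtain ⟨j, hj, hh⟩ := mem_biUnion.1 hh
      refine hR.apply_mem_of_card_eq_two (hJ j hj) (hBB' hv) (hp ⟨j, hj⟩) (subset_span ?_) hh
      exact mem_coe.2 (mem_union_right _ (mem_image_of_mem (c ∘ p) (mem_attach J ⟨j, hj⟩)))

end IsRecoveryFamily

end RecoveryFamilies

section LengthEighteen

variable {ι κ V : Type*} [AddCommGroup V] [Module (ZMod 2) V]
  {c : ι → V} {v : V} {R : κ → Finset ι}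

theorem IsRecoveryFamily.card_pairs_le_five [Module.Finite (ZMod 2) V]
    (hV : finrank (ZMod 2) V ≤ 6) (hR : IsRecoveryFamily c v R) (hv : v ≠ 0)
    (hc : SpanCardLE 4 6 c) {J : Finset κ} (hJ : ∀ j ∈ J, #(R j) = 2) {j₀ : κ} (hj₀ : j₀ ∉ J) :
    #J ≤ 5 := by
  classical
  by_contra! hcard
  obtain ⟨J', hJ', hJ'card⟩ := exists_subset_card_eq hcard
  have hs : #(insert j₀ J') = 7 := by rw [card_insert_of_notMem fun h => hj₀ (hJ' h), hJ'card]
  -- Together with `v`, four of seven representatives span only four dimensions; the sets of at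
  -- least three of them are pairs, so these dimensions hold seven columns.
  choose z hz using hR.nonempty hv
  obtain ⟨T, hT, hTcard, B, hB, hvB, hzB⟩ := exists_subset_forall_mem_span hv (c ∘ z)
    (s := insert j₀ J') (m := 4) (by omega) (by omega) (by omega)
  set W := span (ZMod 2) (B : Set V)
  have hrec : ∀ j ∈ T, 2 ≤ #{h ∈ R j | c h ∈ W} + if j = j₀ then 1 else 0 := fun j hj => by
    split_ifs with hj₀
    · exact Nat.succ_le_succ (card_pos.2 ⟨z j, mem_filter.2 ⟨hz j, hzB j hj⟩⟩)
    · have hj2 := hJ j (hJ' ((mem_insert.1 (hT hj)).resolve_left hj₀))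
      rw [filter_true_of_mem fun h => hR.apply_mem_of_card_eq_two hj2 hvB (hz j) (hzB j hj), hj2]
  have hcount := card_nsmul_le_sum T _ 2 hrec
  rw [sum_add_distrib, sum_ite_eq', hTcard, smul_eq_mul, ← Finset.card_biUnion fun j _ j' _ hne =>
    (hR.disjoint j j' hne).mono (filter_subset _ _) (filter_subset _ _)] at hcount
  have hsix := hc B hB (T.biUnion fun j => {h ∈ R j | c h ∈ W}) (by simp [W])
  split_ifs at hcount <;> omega

theorem HasDistance.nineteen_le_card [Fintype ι] [Fintype κ] [Module.Finite (ZMod 2) V]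
    (hV : finrank (ZMod 2) V = 6) (hc : HasDistance 8 c) (hR : IsRecoveryFamily c v R)
    (hv : v ≠ 0) (hκ : Fintype.card κ = 8) : 19 ≤ Fintype.card ι := by
  classical
  by_contra! hn
  have h12 : SpanCardLE 1 2 c := hc.spanCardLE (by rw [hV]; omega)
  have h34 : SpanCardLE 3 4 c := hc.spanCardLE (by rw [hV]; omega)
  have h46 : SpanCardLE 4 6 c := hc.spanCardLE (by rw [hV]; omega)
  have hcount := hR.three_mul_card_le hv
  set J₁ : Finset κ := {j | #(R j) = 1}
  set J₂ : Finset κ := {j | #(R j) = 2}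
  have hJ₁ : ∀ j ∈ J₁, #(R j) = 1 := by simp [J₁]
  have hcard : #(J₁.biUnion R) = #J₁ := by rw [hR.card_biUnion, sum_const_nat hJ₁, mul_one]
  have hspan : ∀ h ∈ J₁.biUnion R, c h ∈ span (ZMod 2) (({v} : Finset V) : Set V) := by
    intro h hh
    obtain ⟨j, hj, hh⟩ := mem_biUnion.1 hh
    rw [hR.apply_eq_of_card_eq_one (hJ₁ j hj) hh]
    exact subset_span (by simp)
  have hJ₁2 := h12 {v} (by simp) _ hspan
  obtain hempty | hpos := Nat.eq_zero_or_pos #J₁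
  · obtain ⟨J, hJ, hJcard⟩ := exists_subset_card_eq (s := J₂) (n := 6) (by omega)
    obtain ⟨j₀, -, hj₀⟩ := exists_mem_notMem_of_card_lt_card (s := J) (t := univ)
      (by rw [card_univ]; omega)
    have := hR.card_pairs_le_five hV.le hv h46 (fun j hj => (mem_filter.1 (hJ hj)).2) hj₀
    omega
  · obtain ⟨J, hJ, hJcard⟩ := exists_subset_card_eq (s := J₂) (n := 2) (by omega)
    have hJ2 : ∀ j ∈ J, #(R j) = 2 := fun j hj => (mem_filter.1 (hJ hj)).2
    have hfour := hR.card_add_two_mul_card_le (B := {v}) (by rwa [card_singleton, hJcard])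
      hJ2 (subset_span (by simp)) hspan fun j hj => (disjoint_biUnion_left _ _ _).2
        fun j' hj' => hR.disjoint _ _ fun h => by
          simpa [h, hJ2 j hj] using hJ₁ j' hj'
    omega

end LengthEighteen

section PointSets

variable {V : Type*} [AddCommGroup V] [Module (ZMod 2) V]

theorem add_ne_zero_of_ne {v v' : V} (hne : v ≠ v') : v + v' ≠ 0 := by
  rwa [← ZModModule.sub_eq_add, sub_ne_zero]

theorem mem_span_pair_iff {u v v' : V} :
    u ∈ span (ZMod 2) {v, v'} ↔ u = 0 ∨ u = v ∨ u = v' ∨ u = v + v' := by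
  rw [mem_span_pair]
  have hzmod : ∀ a : ZMod 2, a = 0 ∨ a = 1 := by decide
  constructor
  · rintro ⟨a, b, rfl⟩
    rcases hzmod a with rfl | rfl <;> rcases hzmod b with rfl | rfl <;> simp
  · rintro (rfl | rfl | rfl | rfl)
    exacts [⟨0, 0, by simp⟩, ⟨1, 0, by simp⟩, ⟨0, 1, by simp⟩, ⟨1, 1, by simp⟩]

theorem mem_span_insert_iff {u x : V} {S : Set V} :
    u ∈ span (ZMod 2) (insert x S) ↔ u ∈ span (ZMod 2) S ∨ u + x ∈ span (ZMod 2) S := by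
  have hzmod : ∀ a : ZMod 2, a = 0 ∨ a = 1 := by decide
  rw [mem_span_insert']
  constructor
  · rintro ⟨a, ha⟩
    rcases hzmod a with rfl | rfl
    · exact Or.inl (by simpa using ha)
    · exact Or.inr (by simpa using ha)
  · rintro (h | h)
    exacts [⟨0, by simpa using h⟩, ⟨1, by simpa using h⟩]

theorem card_union_image_add [DecidableEq V] {W : Submodule (ZMod 2) V} {u : V} (hu : u ∉ W)
    {P Q : Finset V} (hP : ∀ p ∈ P, p ∈ W) (hQ : ∀ q ∈ Q, q ∈ W) :
    #(P ∪ Q.image (u + ·)) = #P + #Q := by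
  rw [card_union_of_disjoint, card_image_of_injective _ (add_right_injective u)]
  refine disjoint_left.2 fun p hp hpQ => ?_
  obtain ⟨q, hq, rfl⟩ := mem_image.1 hpQ
  exact hu ((W.add_mem_iff_left (hQ q hq)).1 (hP _ hp))

theorem SpanCardLE.card_add_card_le {r t : ℕ} {X : Finset V}
    (hX : SpanCardLE (r + 1) t ((↑) : X → V)) {B : Finset V} (hB : #B ≤ r) {u : V}
    (hu : u ∉ span (ZMod 2) (B : Set V)) {P Q : Finset V}
    (hP : ∀ p ∈ P, p ∈ X ∧ p ∈ span (ZMod 2) (B : Set V))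
    (hQ : ∀ q ∈ Q, u + q ∈ X ∧ q ∈ span (ZMod 2) (B : Set V)) : #P + #Q ≤ t := by
  classical
  rw [← card_union_image_add hu (fun p hp => (hP p hp).2) fun q hq => (hQ q hq).2]
  have hBu : span (ZMod 2) (B : Set V) ≤ span (ZMod 2) ((insert u B : Finset V) : Set V) :=
    span_mono (by simp)
  have hu' : u ∈ span (ZMod 2) ((insert u B : Finset V) : Set V) := subset_span (by simp)
  have hsub : P ∪ Q.image (u + ·) ⊆ X :=
    union_subset (fun p hp => (hP p hp).1) (image_subset_iff.2 fun q hq => (hQ q hq).1)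
  rw [← filter_true_of_mem hsub, ← card_subtype]
  refine hX (insert u B) ((card_insert_le u B).trans (by omega)) _ fun y hy => ?_
  rw [mem_subtype, mem_union, mem_image] at hy
  generalize (y : V) = y at hy
  obtain (hp | ⟨q, hq, rfl⟩) := hy
  exacts [hBu (hP _ hp).2, add_mem hu' (hBu (hQ q hq).2)]

variable [DecidableEq V]

/-- The points of `X` on the lines `{v, u, u + v} ⊆ X` through the point `v` of `X`, and `v`
itself, which the filter admits as `v + v = 0`. -/
def lineUnion (X : Finset V) (v : V) : Finset V := {u ∈ X | u + v ∈ insert 0 X}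

variable {X : Finset V} {v v' : V}

theorem mem_lineUnion {u : V} :
    u ∈ lineUnion X v ↔ u ∈ X ∧ (u = v ∨ u + v ∈ X) := by
  rw [lineUnion, mem_filter, mem_insert, ← ZModModule.sub_eq_add, sub_eq_zero]

theorem card_lineUnion_inter_le_three (hX0 : 0 ∉ X) (hX : SpanCardLE 3 5 ((↑) : X → V))
    (hv : v ∈ X) (hv' : v' ∈ X) (hne : v ≠ v') (hadd : v + v' ∈ X) :
    #(lineUnion X v ∩ lineUnion X v') ≤ 3 := by
  have hv0 : v ≠ 0 := ne_of_mem_of_not_mem hv hX0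
  have hv'0 : v' ≠ 0 := ne_of_mem_of_not_mem hv' hX0
  have hsub : lineUnion X v ∩ lineUnion X v' ⊆ {v, v', v + v'} := by
    intro u hu
    simp only [mem_inter, mem_lineUnion] at hu
    obtain ⟨⟨huX, huv⟩, -, huv'⟩ := hu
    by_contra hu
    simp only [mem_insert, mem_singleton, not_or] at hu
    have hspan : u ∉ span (ZMod 2) (({v, v'} : Finset V) : Set V) := by
      have := ne_of_mem_of_not_mem huX hX0
      simp [mem_span_pair_iff, *]
    have hsix := hX.card_add_card_le (P := {v, v', v + v'}) (Q := {0, v, v'}) card_le_two hspan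
      (by simp [mem_span_pair_iff, *]) (by simp [mem_span_pair_iff, huX, huv.resolve_left hu.1,
        huv'.resolve_left hu.2.1])
    rw [card_eq_three.2 ⟨v, v', v + v', hne, by simpa, by simpa, rfl⟩,
      card_eq_three.2 ⟨0, v, v', hv0.symm, hv'0.symm, hne, rfl⟩] at hsix
    omega
  exact (card_le_card hsub).trans card_le_three

theorem notMem_span_pair_of_mem_lineUnion (hX0 : 0 ∉ X) (hne : v ≠ v') (hadd : v + v' ∉ X) {u : V}
    (hu : u ∈ lineUnion X v ∩ lineUnion X v') :
    u ∈ X ∧ u + v ∈ X ∧ u + v' ∈ X ∧ u ∉ span (ZMod 2) (({v, v'} : Finset V) : Set V) := by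
  simp only [mem_inter, mem_lineUnion] at hu
  obtain ⟨⟨hu, huv⟩, -, huv'⟩ := hu
  have hne_v : u ≠ v := by
    rintro rfl
    exact huv'.elim hne hadd
  have hne_v' : u ≠ v' := by
    rintro rfl
    exact huv.elim hne.symm (add_comm v u ▸ hadd)
  have h0 := ne_of_mem_of_not_mem hu hX0
  have h1 := ne_of_mem_of_not_mem hu hadd
  exact ⟨hu, huv.resolve_left hne_v, huv'.resolve_left hne_v', by simp [mem_span_pair_iff, *]⟩

theorem card_lineUnion_inter_le_one (hX0 : 0 ∉ X) (hX3 : SpanCardLE 3 5 ((↑) : X → V))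
    (hX4 : SpanCardLE 4 7 ((↑) : X → V)) (hv : v ∈ X) (hv' : v' ∈ X) (hne : v ≠ v')
    (hadd : v + v' ∉ X) :
    #(lineUnion X v ∩ lineUnion X v') ≤ 1 := by
  have hv0 : v ≠ 0 := ne_of_mem_of_not_mem hv hX0
  have hv'0 : v' ≠ 0 := ne_of_mem_of_not_mem hv' hX0
  have hthree : #{0, v, v'} = 3 := card_eq_three.2 ⟨0, v, v', hv0.symm, hv'0.symm, hne, rfl⟩
  rw [card_le_one]
  intro u hu u' hu'
  obtain ⟨huX, huv, huv', hu⟩ := notMem_span_pair_of_mem_lineUnion hX0 hne hadd hu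
  obtain ⟨hu'X, hu'v, hu'v', hu'⟩ := notMem_span_pair_of_mem_lineUnion hX0 hne hadd hu'
  by_contra huu'
  by_cases hspan : u' ∈ span (ZMod 2) (({u, v, v'} : Finset V) : Set V)
  · have hall : u + (v + v') ∈ X := by
      rw [coe_insert, mem_span_insert_iff, or_iff_right hu', coe_pair, mem_span_pair_iff,
        or_iff_right (add_ne_zero_of_ne (Ne.symm huu'))] at hspan
      rcases hspan with h | h | h
      · rwa [← h, add_assoc, add_left_comm, ← add_assoc u, ZModModule.add_self, zero_add]
      · rwa [add_comm v, ← h, add_assoc, add_left_comm, ← add_assoc u, ZModModule.add_self,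
          zero_add]
      · rwa [← h, add_left_comm, ZModModule.add_self, add_zero]
    have hsix := hX3.card_add_card_le (P := {v, v'}) (Q := {v + v', 0, v, v'}) card_le_two hu
      (by simp [mem_span_pair_iff, *]) (by simp [mem_span_pair_iff, *])
    rw [card_pair hne, card_insert_of_notMem (by simpa using ⟨add_ne_zero_of_ne hne, hv'0, hv0⟩),
      hthree] at hsix
    omega
  · have hP := card_union_image_add (P := {v, v'}) (Q := {0, v, v'}) hu
      (by simp [mem_span_pair_iff]) (by simp [mem_span_pair_iff])
    have huW : u ∈ span (ZMod 2) {u, v, v'} := subset_span (by simp)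
    have hvW : v ∈ span (ZMod 2) {u, v, v'} := subset_span (by simp)
    have hv'W : v' ∈ span (ZMod 2) {u, v, v'} := subset_span (by simp)
    have height := hX4.card_add_card_le (P := {v, v'} ∪ ({0, v, v'} : Finset V).image (u + ·))
      (Q := {0, v, v'}) card_le_three hspan (by simp [add_mem, *]) (by simp [*])
    rw [hP, card_pair hne, hthree] at height
    omega

end PointSets

section Counting

variable {α : Type*} [DecidableEq α] {T X : Finset α} {N : α → Finset α}

theorem sum_card_filter_mem_mul (T X : Finset α) (N : α → Finset α) (g : α → ℕ) :
    ∑ h ∈ X, #{v ∈ T | h ∈ N v} * g h = ∑ v ∈ T, ∑ h ∈ X ∩ N v, g h := by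
  simp only [card_filter, sum_mul, ite_mul, one_mul, zero_mul]
  rw [sum_comm]
  simp only [← sum_filter, filter_mem_eq_inter]

theorem sum_card_inter_le {v : α} (hv : v ∈ T) (hself : v ∈ N v)
    (hinter : ∀ v' ∈ T, v ≠ v' → #(N v ∩ N v') ≤ if v ∈ N v' then 3 else 1) :
    ∑ v' ∈ T, #(N v ∩ N v') + 3 ≤ #(N v) + #T + 2 * #{v' ∈ T | v ∈ N v'} := by
  calc ∑ v' ∈ T, #(N v ∩ N v') + 3
      = #(N v) + ∑ v' ∈ T.erase v, #(N v ∩ N v') + 3 := by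
        rw [← add_sum_erase _ _ hv, inter_self]
    _ ≤ #(N v) + ∑ v' ∈ T.erase v, (1 + 2 * if v ∈ N v' then 1 else 0) + 3 := by
        gcongr with v' hv'
        have := hinter v' (mem_of_mem_erase hv') (ne_of_mem_erase hv').symm
        split_ifs at this ⊢ <;> simpa
    _ = #(N v) + ∑ v' ∈ T, (1 + 2 * if v ∈ N v' then 1 else 0) := by
        rw [← add_sum_erase _ _ hv, if_pos hself]
        ring
    _ = #(N v) + #T + 2 * #{v' ∈ T | v ∈ N v'} := by
        rw [sum_add_distrib, ← mul_sum, ← card_filter, sum_const, smul_eq_mul, mul_one, add_assoc]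

theorem two_mul_sum_card_le (hT : T ⊆ X) (hN : ∀ v ∈ T, N v ⊆ X) (hself : ∀ v ∈ T, v ∈ N v)
    (hinter : ∀ v ∈ T, ∀ v' ∈ T, v ≠ v' → #(N v ∩ N v') ≤ if v ∈ N v' then 3 else 1) :
    2 * ∑ v ∈ T, #(N v) ≤ 2 * #X + #T * (#T + 1) := by
  let r : α → ℕ := fun h => #{v ∈ T | h ∈ N v}
  have hsum : ∑ h ∈ X, r h = ∑ v ∈ T, #(N v) := by
    have := sum_card_filter_mem_mul T X N 1
    simp only [Pi.one_apply, mul_one, sum_const, smul_eq_mul] at this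
    exact this.trans (sum_congr rfl fun v hv => by rw [inter_eq_right.2 (hN v hv)])
  have hsq : ∑ h ∈ X, r h * r h + 3 * #T ≤ ∑ v ∈ T, #(N v) + #T * #T + 2 * ∑ v ∈ T, r v := by
    have hpairs : ∑ h ∈ X, r h * r h = ∑ v ∈ T, ∑ v' ∈ T, #(N v ∩ N v') := by
      rw [sum_card_filter_mem_mul]
      refine sum_congr rfl fun v hv => ?_
      simpa [inter_eq_right.2 (hN v hv)] using sum_card_filter_mem_mul T (N v) N 1
    have := sum_le_sum fun v hv => sum_card_inter_le hv (hself v hv) (hinter v hv)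
    simp only [sum_add_distrib, ← mul_sum, sum_const, smul_eq_mul] at this
    rw [hpairs]
    linarith
  -- `(r - 1) * (r - 2)` and `(r - 2) * (r - 3)` are nonnegative on integers.
  have houter : ∑ h ∈ X \ T, 3 * r h ≤ ∑ h ∈ X \ T, (r h * r h + 2) := sum_le_sum fun h _ => by
    rcases le_or_gt (r h) 1 with hr | hr <;> nlinarith
  have hinner : ∑ v ∈ T, 5 * r v ≤ ∑ v ∈ T, (r v * r v + 6) := sum_le_sum fun v _ => by
    rcases le_or_gt (r v) 2 with hr | hr <;> nlinarith
  simp only [sum_add_distrib, ← mul_sum, sum_const, smul_eq_mul] at houter hinner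
  have hXT := card_sdiff_add_card_eq_card hT
  rw [← sum_sdiff hT] at hsum hsq
  linarith

end Counting

theorem card_le_four_of_seven_le_card_lineUnion {V : Type*} [AddCommGroup V] [Module (ZMod 2) V]
    [DecidableEq V] {X T : Finset V} (hX : #X ≤ 19) (hX0 : 0 ∉ X)
    (hX3 : SpanCardLE 3 5 ((↑) : X → V)) (hX4 : SpanCardLE 4 7 ((↑) : X → V)) (hT : T ⊆ X)
    (hlines : ∀ v ∈ T, 7 ≤ #(lineUnion X v)) : #T ≤ 4 := by
  by_contra! hcard
  obtain ⟨T', hT', hT'card⟩ := exists_subset_card_eq hcard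
  have hupper : 2 * ∑ v ∈ T', #(lineUnion X v) ≤ 2 * #X + #T' * (#T' + 1) := by
    refine two_mul_sum_card_le (hT'.trans hT) (fun v _ => filter_subset _ _)
      (fun v hv => mem_lineUnion.2 ⟨hT (hT' hv), .inl rfl⟩) fun v hv v' hv' hne => ?_
    have hvX := hT (hT' hv)
    have hv'X := hT (hT' hv')
    split_ifs with hmem
    · exact card_lineUnion_inter_le_three hX0 hX3 hvX hv'X hne
        ((mem_lineUnion.1 hmem).2.resolve_left hne)
    · exact card_lineUnion_inter_le_one hX0 hX3 hX4 hvX hv'X hne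
        fun hadd => hmem (mem_lineUnion.2 ⟨hvX, .inr hadd⟩)
  have hlower := card_nsmul_le_sum T' _ 7 fun v hv => hlines v (hT' hv)
  rw [hT'card] at hupper hlower
  rw [smul_eq_mul] at hlower
  omega

section LengthNineteen

variable {ι κ V : Type*} [AddCommGroup V] [Module (ZMod 2) V] {c : ι → V} {v : V}
  {R : κ → Finset ι}

theorem SpanCardLE.coe_of_subset_range {r t : ℕ} (hc : SpanCardLE r t c) {X : Finset V}
    (hX : (X : Set V) ⊆ Set.range c) : SpanCardLE r t ((↑) : X → V) := by
  classical
  intro B hB T hT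
  choose h hh using fun x : X => hX x.2
  have hinj : Function.Injective h := fun x y hxy => Subtype.ext (by rw [← hh x, ← hh y, hxy])
  rw [← card_image_of_injective T hinj]
  refine hc B hB _ fun i hi => ?_
  obtain ⟨x, hx, rfl⟩ := mem_image.1 hi
  exact hh x ▸ hT x hx

theorem IsRecoveryFamily.notMem_span_pair (hR : IsRecoveryFamily c v R) (hc : SpanCardLE 2 4 c)
    {h₀ : ι} (hh₀ : c h₀ = v) {j j' : κ} (hj : #(R j) = 2) (hj' : #(R j') = 2) (hne : j ≠ j')
    (hh₀j : h₀ ∉ R j) (hh₀j' : h₀ ∉ R j') {h h' : ι} (hh : h ∈ R j) (hh' : h' ∈ R j') :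
    c h ∉ span (ZMod 2) {v, c h'} := by
  classical
  intro hspan
  have hv : v ∈ span (ZMod 2) {v, c h'} := subset_span (by simp)
  have hch' : c h' ∈ span (ZMod 2) {v, c h'} := subset_span (by simp)
  have hfive : #(insert h₀ (R j ∪ R j')) = 5 := by
    rw [card_insert_of_notMem (by simp [hh₀j, hh₀j']),
      card_union_of_disjoint (hR.disjoint j j' hne), hj, hj']
  have hfour := hc {v, c h'} card_le_two (insert h₀ (R j ∪ R j')) fun p hp => by
    rw [coe_pair]
    rcases mem_insert.1 hp with rfl | hp
    · rwa [hh₀]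
    rcases mem_union.1 hp with hp | hp
    · exact hR.apply_mem_of_card_eq_two hj hv hh hspan hp
    · exact hR.apply_mem_of_card_eq_two hj' hv hh' hch' hp
  omega

theorem IsRecoveryFamily.disjoint_of_four_le_card (hR : IsRecoveryFamily c v R) (hv : v ≠ 0)
    (hc : SpanCardLE 2 4 c) {v' : V} (hv' : v' ≠ 0) {S : Finset ι} (hScard : 4 ≤ #S)
    (hS : ∀ h ∈ S, c h = v ∨ c h = v') {j : κ} (hj : #(R j) = 2) : Disjoint S (R j) := by
  classical
  by_contra hmeet
  obtain ⟨h, hhS, hhR⟩ := not_disjoint_iff.1 hmeet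
  obtain ⟨h', hh'R, hne⟩ := exists_mem_ne (hj ▸ one_lt_two) h
  have hadd : c h' + c h = v := hR.apply_add_apply_of_card_eq_two hj hh'R hhR hne
  have hch' : c h' = 0 ∨ c h' = v + v' := by
    rcases hS h hhS with hh | hh
    · exact .inl (by simpa [hh] using hadd)
    · exact .inr (by rw [← hadd, hh, add_assoc, ZModModule.add_self, add_zero])
  have hh'S : h' ∉ S := fun hh'S => by
    rcases hch' with hch' | hch' <;> simpa [hch', hv.symm, hv'.symm, hv, hv'] using hS h' hh'S
  have hfour := hc {v, v'} card_le_two (insert h' S) fun p hp => by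
    rw [coe_pair, mem_span_pair_iff]
    rcases mem_insert.1 hp with rfl | hp
    · tauto
    · have := hS p hp
      tauto
  rw [card_insert_of_notMem hh'S] at hfour
  omega

variable [Fintype ι] [DecidableEq V]

theorem IsRecoveryFamily.apply_mem_lineUnion (hR : IsRecoveryFamily c v R) {j : κ}
    (hj : #(R j) = 2) {h : ι} (hh : h ∈ R j) (h0 : c h ≠ 0) (hv : c h ≠ v) :
    c h ∈ lineUnion ((univ.image c).erase 0) v := by
  obtain ⟨h', hh', hne⟩ := exists_mem_ne (hj ▸ one_lt_two) h
  have hadd : c h + v = c h' := by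
    rw [← hR.apply_add_apply_of_card_eq_two hj hh hh' hne.symm, ← add_assoc, ZModModule.add_self,
      zero_add]
  rw [mem_lineUnion]
  refine ⟨by simp [h0], .inr (mem_erase.2 ⟨add_ne_zero_of_ne hv, ?_⟩)⟩
  rw [hadd]
  exact mem_image_of_mem c (mem_univ h')

theorem IsRecoveryFamily.two_mul_card_lt_card_lineUnion (hR : IsRecoveryFamily c v R) (hv : v ≠ 0)
    (hc : SpanCardLE 2 4 c) {h₀ : ι} (hh₀ : c h₀ = v) {J : Finset κ} (hJcard : 1 < #J)
    (hJ : ∀ j ∈ J, #(R j) = 2 ∧ h₀ ∉ R j) :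
    2 * #J < #(lineUnion ((univ.image c).erase 0) v) := by
  classical
  have hindep : ∀ j ∈ J, ∀ j' ∈ J, j ≠ j' → ∀ h ∈ R j, ∀ h' ∈ R j',
      c h ∉ span (ZMod 2) {v, c h'} := fun j hj j' hj' hne h hh h' hh' =>
    hR.notMem_span_pair hc hh₀ (hJ j hj).1 (hJ j' hj').1 hne (hJ j hj).2 (hJ j' hj').2 hh hh'
  have hne : ∀ j ∈ J, ∀ h ∈ R j, c h ≠ 0 ∧ c h ≠ v := fun j hj h hh => by
    obtain ⟨j', hj', hjj'⟩ := exists_mem_ne hJcard j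
    obtain ⟨h', hh'⟩ := hR.nonempty hv j'
    have := hindep j hj j' hj' hjj'.symm h hh h' hh'
    rw [mem_span_pair_iff] at this
    tauto
  have hcard : #(insert h₀ (J.biUnion R)) = 2 * #J + 1 := by
    rw [card_insert_of_notMem (by simpa using fun j hj => (hJ j hj).2), hR.card_biUnion,
      sum_const_nat fun j hj => (hJ j hj).1, mul_comm]
  rw [← Nat.add_one_le_iff, ← hcard]
  refine card_le_card_of_injOn c (fun h hh => ?_) ?_
  · obtain rfl | ⟨j, hj, hh⟩ := by simpa using hh
    · exact mem_lineUnion.2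
        ⟨mem_erase.2 ⟨hh₀.trans_ne hv, mem_image_of_mem c (mem_univ h)⟩, .inl hh₀⟩
    · exact hR.apply_mem_lineUnion (hJ j hj).1 hh (hne j hj h hh).1 (hne j hj h hh).2
  · rw [coe_insert, Set.injOn_insert (by simpa using fun j hj => (hJ j hj).2)]
    constructor
    · intro h hh h' hh' heq
      obtain ⟨j, hj, hh⟩ := mem_biUnion.1 hh
      obtain ⟨j', hj', hh'⟩ := mem_biUnion.1 hh'
      by_contra hhh'
      obtain rfl | hjj' := eq_or_ne j j'
      · have := hR.apply_add_apply_of_card_eq_two (hJ j hj).1 hh hh' hhh'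
        rw [heq, ZModModule.add_self] at this
        exact hv this.symm
      · exact hindep j hj j' hj' hjj' h hh h' hh' (heq ▸ subset_span (by simp))
    · rintro ⟨h, hh, heq⟩
      obtain ⟨j, hj, hh⟩ := mem_biUnion.1 hh
      exact (hne j hj h hh).2 (heq.trans hh₀)

theorem IsRecoveryFamily.seven_le_card_lineUnion [Fintype κ] (hR : IsRecoveryFamily c v R)
    (hv : v ≠ 0) (hc : SpanCardLE 2 4 c)
    (hlarge : 5 ≤ 2 * #{j | #(R j) = 1} + #{j | #(R j) = 2}) (hJ₁ : #{j | #(R j) = 1} ≤ 1)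
    (hmem : v ∈ Set.range c) : 7 ≤ #(lineUnion ((univ.image c).erase 0) v) := by
  obtain ⟨h, hh⟩ := hmem
  obtain ⟨h₀, hh₀, J, hJcard, hJ⟩ := hR.exists_three_pairs hlarge hJ₁ hh
  have := hR.two_mul_card_lt_card_lineUnion hv hc hh₀ (by omega) hJ
  omega

theorem IsRecoveryFamily.card_singletons_le_one [Fintype κ] (hR : IsRecoveryFamily c v R)
    (hv : v ≠ 0) (hc2 : SpanCardLE 2 4 c) (hc3 : SpanCardLE 3 5 c)
    (hlarge : 5 ≤ 2 * #{j | #(R j) = 1} + #{j | #(R j) = 2}) {v' : V} (hv' : v' ≠ 0)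
    (hne : v ≠ v') (hfiber : 2 ≤ #{h | c h = v'}) : #{j | #(R j) = 1} ≤ 1 := by
  classical
  by_contra! hJ₁
  let S : Finset ι := {h | c h = v ∨ c h = v'}
  have hS : ∀ h ∈ S, c h = v ∨ c h = v' := by simp [S]
  have hScard : #S = #{h | c h = v} + #{h | c h = v'} := by
    rw [← card_union_of_disjoint (disjoint_filter.2 fun h _ hh => hh ▸ hne), ← filter_or]
  have hSspan : ∀ h ∈ S, c h ∈ span (ZMod 2) (({v, v'} : Finset V) : Set V) := fun h hh => by
    rw [coe_pair, mem_span_pair_iff]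
    exact .inr ((hS h hh).imp_right .inl)
  have hSle := hc2 _ card_le_two S hSspan
  have := hR.card_singletons_le
  obtain ⟨j, hj⟩ := card_pos.1 (show 0 < #{j | #(R j) = 2} by omega)
  have hj := (mem_filter.1 hj).2
  have hdisj := hR.disjoint_of_four_le_card hv hc2 hv' (by omega) hS hj
  have hsix := hR.card_add_two_mul_card_le (J := {j}) (B := {v, v'}) (by rwa [card_pair hne])
    (by simpa) (subset_span (by simp)) hSspan (by simpa)
  rw [card_singleton] at hsix
  omega

end LengthNineteen

section Matrices

variable {s n k : ℕ} {G : Matrix (Fin s) (Fin n) (ZMod 2)}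

theorem IsPIRMatrix.exists_isRecoveryFamily (hG : IsPIRMatrix k G) (i : Fin s) :
    ∃ R : Fin k → Finset (Fin n), IsRecoveryFamily G.col (Pi.single i 1) R :=
  let ⟨R, hsum, hdisj⟩ := hG i
  ⟨R, hsum, hdisj⟩

theorem IsPIRMatrix.hasDistance (hG : IsPIRMatrix k G) : HasDistance k G.col := fun f hf => by
  obtain ⟨i, hi⟩ : ∃ i, f (Pi.single i 1) ≠ 0 := by
    by_contra! hzero
    exact hf (LinearMap.pi_ext' fun i => LinearMap.ext_ring (by simpa using hzero i))
  obtain ⟨R, hR⟩ := hG.exists_isRecoveryFamily i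
  simpa using hR.card_le_card_apply_ne_zero hi

theorem IsPIRMatrix.linearIndependent_row (hk : 0 < k) (hG : IsPIRMatrix k G) :
    LinearIndependent (ZMod 2) G.row := by
  rw [Fintype.linearIndependent_iff]
  intro g hg i
  obtain ⟨R, hR⟩ := hG.exists_isRecoveryFamily i
  have hcol : ∀ h, g ⬝ᵥ G.col h = 0 := fun h => by simpa [dotProduct] using congrFun hg h
  calc g i = g ⬝ᵥ Pi.single i 1 := by simp
    _ = ∑ h ∈ R ⟨0, hk⟩, g ⬝ᵥ G.col h := by rw [← hR.sum_eq ⟨0, hk⟩, dotProduct_sum]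
    _ = 0 := by simp [hcol]

theorem IsSystematic.single_mem_range_col (hG : IsSystematic G) (i : Fin s) :
    Pi.single i 1 ∈ Set.range G.col := by
  obtain ⟨f, hf⟩ := hG
  refine ⟨f i, funext fun j => ?_⟩
  simpa [Matrix.one_apply, Pi.single_apply] using congrFun (congrFun hf j) i

theorem IsPIRMatrix.nineteen_le {G : Matrix (Fin 6) (Fin n) (ZMod 2)} (hG : IsPIRMatrix 8 G) :
    19 ≤ n := by
  obtain ⟨R, hR⟩ := hG.exists_isRecoveryFamily 0
  simpa using hG.hasDistance.nineteen_le_card (by simp) hR (by simp) (by simp)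

theorem IsPIRMatrix.not_isSystematic {G : Matrix (Fin 6) (Fin 19) (ZMod 2)}
    (hG : IsPIRMatrix 8 G) : ¬ IsSystematic G := by
  intro hsys
  have h24 : SpanCardLE 2 4 G.col := hG.hasDistance.spanCardLE (by simp)
  have h35 : SpanCardLE 3 5 G.col := hG.hasDistance.spanCardLE (by simp)
  have h47 : SpanCardLE 4 7 G.col := hG.hasDistance.spanCardLE (by simp)
  let e : Fin 6 → Fin 6 → ZMod 2 := fun i => Pi.single i 1
  have he : LinearIndependent (ZMod 2) e := Pi.linearIndependent_single_one (Fin 6) (ZMod 2)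
  choose R hR using hG.exists_isRecoveryFamily
  have hcol := hsys.single_mem_range_col
  have hlarge : ∀ i, 5 ≤ 2 * #{j | #(R i j) = 1} + #{j | #(R i j) = 2} := fun i => by
    have := (hR i).three_mul_card_le (he.ne_zero i)
    rw [Fintype.card_fin, Fintype.card_fin] at this
    omega
  let X : Finset (Fin 6 → ZMod 2) := (univ.image G.col).erase 0
  have hX : (X : Set (Fin 6 → ZMod 2)) ⊆ Set.range G.col := fun x hx => by
    simpa using mem_of_mem_erase hx
  have hXcard : #X ≤ 19 := (card_erase_le.trans card_image_le).trans_eq (card_fin 19)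
  let I : Finset (Fin 6) := {i | #{j | #(R i j) = 1} ≤ 1}
  have hI : #(I.image e) ≤ 4 := by
    refine card_le_four_of_seven_le_card_lineUnion hXcard (notMem_erase 0 _)
      (h35.coe_of_subset_range hX) (h47.coe_of_subset_range hX) ?_ ?_
    · exact image_subset_iff.2 fun i _ => mem_erase.2 ⟨he.ne_zero i, by simpa using hcol i⟩
    · exact forall_mem_image.2 fun i hi => (hR i).seven_le_card_lineUnion (he.ne_zero i) h24
        (hlarge i) (mem_filter.1 hi).2 (hcol i)
  have hIc : #Iᶜ ≤ 1 := by
    refine card_le_one.2 fun i hi i' hi' => ?_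
    by_contra hne
    have hi : 1 < #{j | #(R i j) = 1} := by simpa [I] using hi
    have hi' : 1 < #{j | #(R i' j) = 1} := by simpa [I] using hi'
    exact hi.not_ge <| (hR i).card_singletons_le_one (he.ne_zero i) h24 h35 (hlarge i)
      (he.ne_zero i') (he.injective.ne hne) (hi'.trans_le (hR i').card_singletons_le)
  rw [card_image_of_injective _ he.injective] at hI
  have := card_add_card_compl I
  rw [Fintype.card_fin] at this
  omega

end Matrices

section OptimalLength

/-- The entry at `i` lists eight disjoint recovery sets of the `i`-th unit vector in `G19`, columns
being numbered from `0`. -/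
def recoverySetsG19 : Fin 6 → Fin 8 → Finset (Fin 19) :=
  ![![{0, 1}, {2, 3}, {7, 8}, {12, 13}, {16, 17}, {4, 11, 14}, {5, 9, 18}, {6, 10, 15}],
    ![{1, 18}, {4, 5}, {6, 8}, {11, 13}, {14, 15}, {0, 3, 10}, {2, 12, 16}, {7, 9, 17}],
    ![{0, 16}, {1, 17}, {4, 6}, {5, 8}, {10, 13}, {2, 9, 14}, {3, 12, 18}, {7, 11, 15}],
    ![{1, 15}, {2, 7}, {3, 8}, {9, 13}, {14, 18}, {0, 5, 11}, {4, 10, 16}, {6, 12, 17}],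
    ![{3, 9}, {5, 10}, {6, 11}, {7, 12}, {8, 13}, {0, 14, 17}, {1, 2, 4}, {15, 16, 18}],
    ![{0, 12}, {1, 13}, {9, 15}, {10, 17}, {11, 18}, {2, 5, 6}, {3, 4, 7}, {8, 14, 16}]]

theorem isPIRMatrix_G19 : IsPIRMatrix 8 G19 := by
  have hsum : ∀ i j, ∀ i', ∑ h ∈ recoverySetsG19 i j, G19 i' h =
      (Pi.single i 1 : Fin 6 → ZMod 2) i' := by decide +kernel
  have hdisj : ∀ i j j', j ≠ j' → Disjoint (recoverySetsG19 i j) (recoverySetsG19 i j') := by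
    decide +kernel
  refine fun i => ⟨recoverySetsG19 i, fun j => ?_, hdisj i⟩
  funext i'
  rw [Finset.sum_apply]
  exact hsum i j i'

theorem isProjective_G19 : IsProjective G19 := by
  have hcol : ∀ h h' : Fin 19, h ≠ h' → ∀ a b : ZMod 2,
      (∀ i, a * G19 i h + b * G19 i h' = 0) → a = 0 ∧ b = 0 := by decide +kernel
  intro h h' hne
  rw [LinearIndependent.pair_iff]
  intro a b hab
  exact hcol h h' hne a b fun i => by simpa using congrFun hab i

theorem exists_isGeneratorMatrix_G19 :
    ∃ C : Submodule (ZMod 2) (Fin 19 → ZMod 2), IsGeneratorMatrix G19 C :=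
  ⟨_, isPIRMatrix_G19.linearIndependent_row (by norm_num), rfl⟩

theorem P_six_eight : P 6 8 = 19 := by
  have hmem : 19 ∈ {n : ℕ | ∃ C : Submodule (ZMod 2) (Fin n → ZMod 2), IsPIRCode 6 8 C} := by
    obtain ⟨C, hC⟩ := exists_isGeneratorMatrix_G19
    exact ⟨C, G19, hC, isPIRMatrix_G19⟩
  refine le_antisymm (Nat.sInf_le hmem) (le_csInf ⟨_, hmem⟩ ?_)
  rintro n ⟨C, G, -, hG⟩
  exact hG.nineteen_le

theorem IsSystematicPIRCode.twenty_le {n : ℕ} {C : Submodule (ZMod 2) (Fin n → ZMod 2)}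
    (hC : IsSystematicPIRCode 6 8 C) : 20 ≤ n := by
  obtain ⟨G, -, hG, hsys⟩ := hC
  rcases hG.nineteen_le.eq_or_lt with rfl | h
  · exact (hG.not_isSystematic hsys).elim
  · exact h

end OptimalLength

end PIR

theorem mainTheorem11 :
    PIR.P 6 8 = 19 ∧
    ((∃ C : Submodule (ZMod 2) (Fin 19 → ZMod 2), PIR.IsGeneratorMatrix PIR.G19 C) ∧
      PIR.IsPIRMatrix 8 PIR.G19 ∧ PIR.IsProjective PIR.G19 ∧ ¬ PIR.IsSystematic PIR.G19) ∧
    (∀ (n : ℕ) (C : Submodule (ZMod 2) (Fin n → ZMod 2)),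
      PIR.IsSystematicPIRCode 6 8 C → 20 ≤ n) ∧
    ¬ (∀ s k : ℕ, 1 ≤ s → 1 ≤ k →
      ∃ C : Submodule (ZMod 2) (Fin (PIR.P s k) → ZMod 2), PIR.IsSystematicPIRCode s k C) := by
  refine ⟨PIR.P_six_eight, ⟨PIR.exists_isGeneratorMatrix_G19, PIR.isPIRMatrix_G19,
    PIR.isProjective_G19, PIR.isPIRMatrix_G19.not_isSystematic⟩, fun n C hC => hC.twenty_le,
    fun h => ?_⟩
  obtain ⟨C, hC⟩ := h 6 8 (by norm_num) (by norm_num)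
  have := hC.twenty_le
  rw [PIR.P_six_eight] at this
  omega
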